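/- Theorem 2. The model of computation is the word-RAM with words of $W = \Omega(\log n)$ bits: memory cells hold words and are addressed by words, there are the usual unit-cost operations on words, and space is measured in words. There are a query program and a constant $C$ with the following property. Let $G$ be a tree on $n$ nodes, named by the numbers $0, \dots, n-1$, each node of which is coloured black or white. Then there is an index for $G$ that consists of at most $C n^2$ words, each of them a number less than $C n^2$ (so that it takes $O(\log n)$ bits), such that on every word-RAM with $2^W \ge C n^2$, with the index stored in its memory, the following holds. Given the numbers $b, w < 2^W$ of black and white elements of a non-empty multiset $M$ of colours, $|M| = b + w \ge 1$, the query program stops after at most $C\,|M|$ time steps and has found a match for $M$ if there is one: it outputs a list, without repetitions, of the nodes of a connected subgraph of $G$ that has exactly $b$ black and exactly $w$ white nodes; if there is no such subgraph, it outputs the empty list. The query leaves the index unchanged. In short: for trees with two colours there is an $O(n^2)$-space index with which a match can be found in $O(|M|)$ time. -/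

import Mathlib

/-! ### The word-RAM

A machine with word length `W` works on words, the natural numbers below `2 ^ W`.  It has
registers and a random access memory whose cells are addressed by words, and a program is a finite
list of instructions.  Every instruction takes one time step, and all arithmetic is modulo
`2 ^ W`. -/

namespace WordRAM

/-- The binary word operations. -/
inductive BinOp where
  | add | sub | mul | and | or | xor | shl | shr

/-- The value of a binary operation on words of `W` bits. -/
def BinOp.eval (W : ℕ) : BinOp → ℕ → ℕ → ℕ
  | .add, x, y => (x + y) % 2 ^ W
  | .sub, x, y => (x + (2 ^ W - y)) % 2 ^ W
  | .mul, x, y => (x * y) % 2 ^ W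
  | .and, x, y => x &&& y
  | .or, x, y => x ||| y
  | .xor, x, y => x ^^^ y
  | .shl, x, y => (x * 2 ^ y) % 2 ^ W
  | .shr, x, y => x / 2 ^ y

/-- The instructions.  Registers and jump targets are named by natural numbers. -/
inductive Instr where
  /-- `r[d] := k` -/
  | const (d k : ℕ)
  /-- `r[d] := r[a]` -/
  | copy (d a : ℕ)
  /-- `r[d] := r[a] op r[b]` -/
  | bin (op : BinOp) (d a b : ℕ)
  /-- `r[d] := mem[r[a]]` -/
  | load (d a : ℕ)
  /-- `mem[r[a]] := r[b]` -/
  | store (a b : ℕ)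
  /-- `goto k` -/
  | jump (k : ℕ)
  /-- `if r[a] = r[b] then goto k` -/
  | jumpEq (a b k : ℕ)
  /-- `if r[a] < r[b] then goto k` -/
  | jumpLt (a b k : ℕ)
  /-- append `r[a]` to the output -/
  | output (a : ℕ)
  /-- stop -/
  | halt

/-- A program is a finite list of instructions; it starts at its first instruction. -/
abbrev Program := List Instr

/-- A configuration: program counter, registers, memory, and the words output so far. -/
structure Config where
  pc : ℕ
  reg : ℕ → ℕ
  mem : ℕ → ℕ
  out : List ℕ

/-- The effect of one instruction; `none` means that the machine stops. -/
def Instr.exec (W : ℕ) (c : Config) : Instr → Option Config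
  | .const d k => some { c with pc := c.pc + 1, reg := Function.update c.reg d (k % 2 ^ W) }
  | .copy d a => some { c with pc := c.pc + 1, reg := Function.update c.reg d (c.reg a) }
  | .bin op d a b =>
      some { c with pc := c.pc + 1,
                    reg := Function.update c.reg d (op.eval W (c.reg a) (c.reg b)) }
  | .load d a => some { c with pc := c.pc + 1, reg := Function.update c.reg d (c.mem (c.reg a)) }
  | .store a b => some { c with pc := c.pc + 1, mem := Function.update c.mem (c.reg a) (c.reg b) }
  | .jump k => some { c with pc := k }
  | .jumpEq a b k => some { c with pc := if c.reg a = c.reg b then k else c.pc + 1 }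
  | .jumpLt a b k => some { c with pc := if c.reg a < c.reg b then k else c.pc + 1 }
  | .output a => some { c with pc := c.pc + 1, out := c.out ++ [c.reg a] }
  | .halt => none

/-- One time step; `none` means that the machine has stopped. -/
def step (W : ℕ) (P : Program) (c : Config) : Option Config :=
  (P[c.pc]?).bind (Instr.exec W c)

/-- The configuration after exactly `t` time steps, if the machine has not stopped before. -/
def steps (W : ℕ) (P : Program) : ℕ → Config → Option Config
  | 0, c => some c
  | t + 1, c => (step W P c).bind (steps W P t)

/-- Started in `c`, the machine stops after at most `T` time steps, in configuration `c'`. -/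
def HaltsWithin (W : ℕ) (P : Program) (T : ℕ) (c c' : Config) : Prop :=
  ∃ t ≤ T, steps W P t c = some c' ∧ step W P c' = none

/-- The start configuration with memory contents `mem` and with the two words `x` and `y` as input
in registers `0` and `1`; the other registers are `0`, and nothing has been output. -/
def start (mem : ℕ → ℕ) (x y : ℕ) : Config where
  pc := 0
  reg := fun r => if r = 0 then x else if r = 1 then y else 0
  mem := mem
  out := []

/-- The first `idx.length` memory cells contain the list `idx`. -/
def Stores (mem : ℕ → ℕ) (idx : List ℕ) : Prop :=
  ∀ (i : ℕ) (h : i < idx.length), mem i = idx[i]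

end WordRAM

/-! ### Matches -/

/-- The node set `S` is a match for the multiset of `b` black and `w` white nodes: it spans a
connected (in particular non-empty) subgraph of `G` with exactly `b` black and `w` white nodes.
The colour `true` is white, and `false` is black. -/
def IsMatch {V : Type*} (G : SimpleGraph V) (white : V → Bool) (b w : ℕ) (S : Finset V) : Prop :=
  (G.induce (S : Set V)).Connected ∧
    (S.filter (fun v => white v = false)).card = b ∧
    (S.filter (fun v => white v = true)).card = w

/-- `out` is a correct answer to the query `(b, w)`: it lists the nodes of a match, each exactly
once, if there is a match, and it is empty if there is none. -/
def IsAnswer {n : ℕ} (G : SimpleGraph (Fin n)) (white : Fin n → Bool) (b w : ℕ)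
    (out : List ℕ) : Prop :=
  ((∃ S, IsMatch G white b w S) →
    ∃ l : List (Fin n), l.Nodup ∧ IsMatch G white b w l.toFinset ∧ out = l.map Fin.val) ∧
  ((¬ ∃ S, IsMatch G white b w S) → out = [])

/-- With `query` as the query program, the list of words `idx` is an index for the two-coloured
graph `G` that answers every query `(b, w)` with `1 ≤ b + w` in at most `C * (b + w)` time steps on
the word-RAM with word length `W`.  A query may find anything in the memory cells that do not
belong to the index, and it has to leave the index intact, so that queries can be repeated. -/
def IsIndexFor {n : ℕ} (G : SimpleGraph (Fin n)) (white : Fin n → Bool)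
    (query : WordRAM.Program) (C W : ℕ) (idx : List ℕ) : Prop :=
  ∀ mem : ℕ → ℕ, (∀ a, mem a < 2 ^ W) → WordRAM.Stores mem idx →
    ∀ b w : ℕ, b < 2 ^ W → w < 2 ^ W → 1 ≤ b + w →
      ∃ c : WordRAM.Config,
        WordRAM.HaltsWithin W query (C * (b + w)) (WordRAM.start mem b w) c ∧
        IsAnswer G white b w c.out ∧
        WordRAM.Stores c.mem idx

/-! Fix a size `m`, and let `S` and `T` be connected sets of `m` nodes with the fewest and the most
black nodes. In a tree, one can slide from `S` to `T` along a list of distinct nodes, all of whose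
windows of length `m` are connected (`IsTree.exists_slides`). Moving a window by one place changes
its number of black nodes by at most one, so every number between the extremes occurs
(`exists_eq_of_le_of_succ_le`). One list per size thus contains a match for every realizable
multiset of that size (`IsTree.exists_windows`).

The nodes of a list are distinct, so it has at most `n` entries, and the lists for sizes `0, …, n`
fit into `(n + 1) * n` cells. A table of `(n + 1) ^ 2` pointers gives the start of the window for
each pair `(b, w)`. A query is then one table lookup followed by copying `b + w` consecutive cells
to the output. -/

/-! ### Growing connected sets node by node -/

namespace SimpleGraph

variable {V : Type*} {G : SimpleGraph V}

/-- Starting from the node set `K`, the nodes of the list can be added one after the other so that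
each of them is adjacent to a node present already. -/
def Attaches (G : SimpleGraph V) : Set V → List V → Prop
  | _, [] => True
  | K, v :: l => (∃ u ∈ K, G.Adj u v) ∧ Attaches G (insert v K) l

namespace Attaches

lemma mono {l : List V} : ∀ {K K' : Set V}, K ⊆ K' → G.Attaches K l → G.Attaches K' l := by
  induction l with
  | nil => intros; trivial
  | cons v l ih =>
    rintro K K' h ⟨⟨u, hu, huv⟩, hl⟩
    exact ⟨⟨u, h hu, huv⟩, ih (Set.insert_subset_insert h) hl⟩

lemma append {l₂ : List V} {l₁ : List V} : ∀ {K : Set V}, G.Attaches K l₁ →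
    G.Attaches (K ∪ {x | x ∈ l₁}) l₂ → G.Attaches K (l₁ ++ l₂) := by
  induction l₁ with
  | nil => intro K _ h; simpa using h
  | cons v l ih =>
    rintro K ⟨h, hl⟩ h₂
    refine ⟨h, ih hl (h₂.mono ?_)⟩
    intro x; simp; tauto

lemma take {l : List V} : ∀ {K : Set V} (i : ℕ), G.Attaches K l → G.Attaches K (l.take i) := by
  induction l with
  | nil => intro K i h; simpa using h
  | cons v l ih =>
    rintro K (_ | i) h
    · trivial
    · exact ⟨h.1, ih i h.2⟩

lemma connected {l : List V} : ∀ {K : Set V}, (G.induce K).Connected → G.Attaches K l →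
    (G.induce (K ∪ {x | x ∈ l})).Connected := by
  induction l with
  | nil =>
    intro K hK _
    have e : K ∪ {x | x ∈ ([] : List V)} = K := by simp
    rwa [e]
  | cons v l ih =>
    rintro K hK ⟨⟨u, hu, huv⟩, hl⟩
    have h : (G.induce (insert v K)).Connected := by
      have := induce_union_connected (induce_pair_connected_of_adj huv).preconnected
        hK.preconnected ⟨u, by simp, hu⟩
      have e : insert v K = {u, v} ∪ K := by
        ext x; simp; constructor
        · tauto
        · rintro ((rfl | rfl) | h) <;> tauto
      rwa [e]
    have e : K ∪ {x | x ∈ v :: l} = insert v K ∪ {x | x ∈ l} := by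
      ext x; simp; tauto
    rw [e]
    exact ih h hl

end Attaches

lemma attaches_of_isChain {l : List V} : ∀ {q : V}, List.IsChain G.Adj (q :: l) →
    G.Attaches {q} l := by
  induction l with
  | nil => intros; trivial
  | cons v l ih =>
    intro q h
    rw [List.isChain_cons_cons] at h
    exact ⟨⟨q, rfl, h.1⟩, (ih h.2).mono (by simp)⟩

lemma induce_singleton_connected (v : V) : (G.induce {v}).Connected := by
  have : Unique (({v} : Set V) : Type _) := inferInstance
  exact ⟨fun a b => by rw [Subsingleton.elim a b]⟩

/-- A proper non-empty subset of a connected set has a neighbour in the set. -/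
lemma exists_adj_of_ssubset {S I : Set V} (hS : (G.induce S).Connected) (hI : I.Nonempty)
    (h : I ⊂ S) : ∃ u ∈ I, ∃ v ∈ S, v ∉ I ∧ G.Adj u v := by
  obtain ⟨x, hx⟩ := hI
  obtain ⟨hIS, y, hyS, hyI⟩ := Set.ssubset_iff_exists.1 h
  obtain ⟨p⟩ := hS.preconnected ⟨x, hIS hx⟩ ⟨y, hyS⟩
  obtain ⟨d, -, h₁, h₂⟩ := p.exists_boundary_dart {z | z.1 ∈ I} hx hyI
  exact ⟨_, h₁, _, d.snd.2, h₂, d.adj⟩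

/-- As long as nodes of `S` are missing, some edge leads from the part built so far to one of them;
that node comes next. -/
lemma exists_attaches [DecidableEq V] {S : Finset V} (hS : (G.induce (S : Set V)).Connected) :
    ∀ (k : ℕ) {I : Finset V}, I.Nonempty → I ⊆ S → (S \ I).card = k →
    ∃ l : List V, l.Nodup ∧ l.toFinset = S \ I ∧ G.Attaches (I : Set V) l := by
  intro k
  induction k with
  | zero =>
    intro I _ _ h
    exact ⟨[], List.nodup_nil, by simpa using (Finset.card_eq_zero.1 h).symm, trivial⟩
  | succ k ih =>
    intro I hI hIS h
    have hne : I ≠ S := by rintro rfl; simp at h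
    obtain ⟨u, hu, v, hv, hvI, huv⟩ := exists_adj_of_ssubset hS (I := (I : Set V)) (by simpa)
      (by exact_mod_cast Finset.ssubset_iff_subset_ne.2 ⟨hIS, hne⟩)
    have hv : v ∈ S := by simpa using hv
    have hvI : v ∉ I := by simpa using hvI
    have e : S \ insert v I = (S \ I).erase v := by ext; simp; tauto
    obtain ⟨l, h₁, h₂, h₃⟩ := ih (I := insert v I) (by simp)
      (Finset.insert_subset hv hIS)
      (by rw [e, Finset.card_erase_of_mem (by simp [hv, hvI]), h]; simp)
    refine ⟨v :: l, ?_, ?_, ⟨u, hu, huv⟩, by simpa using h₃⟩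
    · rw [List.nodup_cons]
      refine ⟨fun hm => ?_, h₁⟩
      rw [← List.mem_toFinset, h₂] at hm
      simp at hm
    · rw [List.toFinset_cons, h₂, e, Finset.insert_erase (by simp [hv, hvI])]

/-- The intersection of two subtrees of a tree is a subtree. -/
lemma IsAcyclic.induce_inter_connected (hG : G.IsAcyclic) {S T : Set V}
    (hS : (G.induce S).Connected) (hT : (G.induce T).Connected) (h : (S ∩ T).Nonempty) :
    (G.induce (S ∩ T)).Connected := by
  classical
  have : Nonempty ↥(S ∩ T) := h.to_subtype
  refine ⟨?_⟩
  rintro ⟨x, hxS, hxT⟩ ⟨y, hyS, hyT⟩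
  obtain ⟨p, hp⟩ := (hS.preconnected ⟨x, hxS⟩ ⟨y, hyS⟩).exists_isPath
  obtain ⟨q, hq⟩ := (hT.preconnected ⟨x, hxT⟩ ⟨y, hyT⟩).exists_isPath
  let p' : G.Walk x y := p.map (Embedding.induce S).toHom
  let q' : G.Walk x y := q.map (Embedding.induce T).toHom
  have hp' : p'.IsPath := hp.map Subtype.val_injective
  have hq' : q'.IsPath := hq.map Subtype.val_injective
  -- Paths in a forest are unique, so the path within `S` and the path within `T` are the same and
  -- lie in both sets.
  have e : p' = q' := congrArg Subtype.val ((hG.subsingleton_path x y).elim ⟨p', hp'⟩ ⟨q', hq'⟩)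
  have h₁ : ∀ z ∈ p'.support, z ∈ S := by
    intro z hz
    rw [show p'.support = p.support.map Subtype.val from p.support_map _, List.mem_map] at hz
    obtain ⟨a, -, rfl⟩ := hz
    exact a.2
  have h₂ : ∀ z ∈ p'.support, z ∈ T := by
    intro z hz
    rw [e] at hz
    rw [show q'.support = q.support.map Subtype.val from q.support_map _, List.mem_map] at hz
    obtain ⟨a, -, rfl⟩ := hz
    exact a.2
  exact ⟨p'.induce (S ∩ T) fun z hz => ⟨h₁ z hz, h₂ z hz⟩⟩

/-- The bounds on `i` and `m` say that the window covers the core `c`. It is then `c` with an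
initial part of `a` and one of `b`, both of which grow out of `c`. -/
lemma window_connected {a b c : List V} (hc : (G.induce {x | x ∈ c}).Connected)
    (ha : G.Attaches {x | x ∈ c} a) (hb : G.Attaches {x | x ∈ c} b) {i m : ℕ}
    (hi : i ≤ a.length) (hm : a.length + c.length ≤ i + m) :
    (G.induce {x | x ∈ ((a.reverse ++ c ++ b).drop i).take m}).Connected := by
  have h₁ := (ha.take (a.length - i)).connected hc
  have h₂ := (hb.take (i + m - a.length - c.length)).connected hc
  obtain ⟨x, hx⟩ := hc.nonempty
  have := induce_union_connected h₁.preconnected h₂.preconnected ⟨x, .inl hx, .inl hx⟩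
  have e : ((a.reverse ++ c ++ b).drop i).take m =
      (a.take (a.length - i)).reverse ++ (c ++ b.take (i + m - a.length - c.length)) := by
    rw [List.append_assoc, List.drop_append_of_le_length (by simpa), List.drop_reverse,
      List.take_append, List.take_of_length_le (l := (a.take _).reverse) (by simp; omega),
      List.take_append, List.take_of_length_le (l := c) (by simp; omega)]
    congr 3
    simp; omega
  have e' : {x | x ∈ ((a.reverse ++ c ++ b).drop i).take m} =
      {x | x ∈ c} ∪ {x | x ∈ a.take (a.length - i)} ∪
        ({x | x ∈ c} ∪ {x | x ∈ b.take (i + m - a.length - c.length)}) := by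
    ext x
    rw [e]
    simp; tauto
  rwa [e']

/-! ### Sliding from one connected set to another -/

/-- The connected sets `S` and `T` of `m` nodes are the first and the last window of a list of
distinct nodes all of whose windows of length `m` are connected. -/
def Slides [DecidableEq V] (G : SimpleGraph V) (m : ℕ) (S T : Finset V) (l : List V) : Prop :=
  l.Nodup ∧ m ≤ l.length ∧ (l.take m).toFinset = S ∧ (l.drop (l.length - m)).toFinset = T ∧
    ∀ i, i + m ≤ l.length → (G.induce {x | x ∈ (l.drop i).take m}).Connected

/-- The core is `S ∩ T`, connected by acyclicity. The list gives up `S \ T` in the reverse of an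
attaching order and takes in `T \ S` in an attaching order; every window covers the core. -/
lemma exists_slides_of_inter [DecidableEq V] (hG : G.IsAcyclic) {m : ℕ} {S T : Finset V}
    (hS : (G.induce (S : Set V)).Connected) (hT : (G.induce (T : Set V)).Connected)
    (hSm : S.card = m) (hTm : T.card = m) (h : (S ∩ T).Nonempty) : ∃ l, G.Slides m S T l := by
  have hI := hG.induce_inter_connected hS hT (by exact_mod_cast h)
  obtain ⟨a, ha, haS, haA⟩ := exists_attaches hS _ h Finset.inter_subset_left rfl
  obtain ⟨b, hb, hbT, hbA⟩ := exists_attaches hT _ h Finset.inter_subset_right rfl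
  set c := (S ∩ T).toList with hc
  have hcm : ∀ x, x ∈ c ↔ x ∈ S ∧ x ∈ T := by simp [hc]
  have ham : ∀ x, x ∈ a ↔ x ∈ S ∧ x ∉ T := by
    intro x; rw [← List.mem_toFinset, haS]; simp
  have hbm : ∀ x, x ∈ b ↔ x ∈ T ∧ x ∉ S := by
    intro x; rw [← List.mem_toFinset, hbT]; simp
  have hcs : {x | x ∈ c} = ((S ∩ T : Finset V) : Set V) := by ext; simp [hc]
  have hal : a.length + c.length = m := by
    rw [← List.toFinset_card_of_nodup ha, haS, hc, Finset.length_toList,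
      Finset.card_sdiff_add_card_eq_card Finset.inter_subset_left, hSm]
  have hbl : b.length + c.length = m := by
    rw [← List.toFinset_card_of_nodup hb, hbT, hc, Finset.length_toList,
      Finset.card_sdiff_add_card_eq_card Finset.inter_subset_right, hTm]
  refine ⟨a.reverse ++ c ++ b, ?_, ?_, ?_, ?_, ?_⟩
  · have := (S ∩ T).nodup_toList
    simp only [List.nodup_append, List.mem_append, List.mem_reverse, List.nodup_reverse]
    refine ⟨⟨ha, this, ?_⟩, hb, ?_⟩
    · rintro x hx y hy rfl
      have := (ham x).1 hx; have := (hcm x).1 hy; tauto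
    · rintro x hx y hy rfl
      have := ham x; have := hcm x; have := hbm x; tauto
  · simp; omega
  · rw [List.take_left' (by simp; omega)]
    ext x; simp [ham, hcm]; tauto
  · rw [List.append_assoc, List.drop_left' (by simp; omega)]
    ext x; simp [hbm, hcm]; tauto
  · intro i hi
    simp at hi
    refine window_connected ?_ ?_ ?_ ?_ ?_
    · rw [hcs, Finset.coe_inter]; exact hI
    · rwa [hcs]
    · rwa [hcs]
    · omega
    · omega

/-- A shortest path from `S` to `T` bridges the gap. No core is common to all windows, but each
window contains a node of the path from which both of its sides grow. -/
lemma exists_slides_of_disjoint [DecidableEq V] (hG : G.Connected) {m : ℕ} {S T : Finset V}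
    (hS : (G.induce (S : Set V)).Connected) (hT : (G.induce (T : Set V)).Connected)
    (hSm : S.card = m) (hTm : T.card = m) (h : Disjoint S T) : ∃ l, G.Slides m S T l := by
  have hSn : S.Nonempty := by obtain ⟨x, hx⟩ := hS.nonempty; exact ⟨x, hx⟩
  have hTn : T.Nonempty := by obtain ⟨x, hx⟩ := hT.nonempty; exact ⟨x, hx⟩
  -- Minimal distance makes the path meet `S` only in `s` and `T` only in `t`, so the concatenated
  -- list has no repetitions.
  obtain ⟨⟨s, t⟩, hst, hmin⟩ := (S ×ˢ T).exists_min_image (fun x => G.dist x.1 x.2)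
    (hSn.product hTn)
  simp only [Finset.mem_product, Prod.forall] at hst hmin
  obtain ⟨p, hp, hpl⟩ := hG.exists_path_of_dist s t
  have hpS : ∀ x ∈ p.support, x ∈ S → x = s := by
    intro x hx hxS
    have h₁ := hmin x t ⟨hxS, hst.2⟩
    have h₂ := dist_le (p.dropUntil x hx)
    have h₃ := congrArg Walk.length (p.take_spec hx)
    rw [Walk.length_append] at h₃
    exact (Walk.eq_of_length_eq_zero (p := p.takeUntil x hx) (by omega)).symm
  have hpT : ∀ x ∈ p.support, x ∈ T → x = t := by
    intro x hx hxT
    have h₁ := hmin s x ⟨hst.1, hxT⟩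
    have h₂ := dist_le (p.takeUntil x hx)
    have h₃ := congrArg Walk.length (p.take_spec hx)
    rw [Walk.length_append] at h₃
    exact Walk.eq_of_length_eq_zero (p := p.dropUntil x hx) (by omega)
  obtain ⟨a, ha, haS, haA⟩ := exists_attaches hS _ (Finset.singleton_nonempty s)
    (by simpa using hst.1) rfl
  obtain ⟨b, hb, hbT, hbA⟩ := exists_attaches hT _ (Finset.singleton_nonempty t)
    (by simpa using hst.2) rfl
  have ham : ∀ x, x ∈ a ↔ x ∈ S ∧ x ≠ s := by
    intro x; rw [← List.mem_toFinset, haS]; simp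
  have hbm : ∀ x, x ∈ b ↔ x ∈ T ∧ x ≠ t := by
    intro x; rw [← List.mem_toFinset, hbT]; simp
  have hal : a.length + 1 = m := by
    rw [← List.toFinset_card_of_nodup ha, haS, ← hSm,
      ← Finset.card_sdiff_add_card_eq_card (s := {s}) (t := S) (by simpa using hst.1)]; simp
  have hbl : b.length + 1 = m := by
    rw [← List.toFinset_card_of_nodup hb, hbT, ← hTm,
      ← Finset.card_sdiff_add_card_eq_card (s := {t}) (t := T) (by simpa using hst.2)]; simp
  have hlen : 0 < p.support.length := by simp
  have hdisj : ∀ x, x ∈ S → x ∉ T := fun x hx => Finset.disjoint_left.1 h hx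
  obtain ⟨c₁, hc₁⟩ : ∃ c, p.support = s :: c := ⟨_, p.cons_tail_support.symm⟩
  obtain ⟨c₂, hc₂⟩ : ∃ c, p.support = c ++ [t] := ⟨_, p.dropLast_support_concat.symm⟩
  have hchain : List.IsChain G.Adj p.support := p.isChain_adj_support
  refine ⟨a.reverse ++ p.support ++ b, ?_, ?_, ?_, ?_, ?_⟩
  · simp only [List.nodup_append, List.mem_append, List.mem_reverse, List.nodup_reverse]
    refine ⟨⟨ha, hp.support_nodup, ?_⟩, hb, ?_⟩
    · rintro x hx y hy rfl
      have := (ham x).1 hx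
      exact this.2 (hpS x hy this.1)
    · rintro x (hx | hx) y hy rfl
      · exact hdisj x ((ham x).1 hx).1 ((hbm x).1 hy).1
      · have := (hbm x).1 hy
        exact this.2 (hpT x hx this.1)
  · simp; omega
  · have e : a.reverse ++ p.support ++ b = (a.reverse ++ [s]) ++ (c₁ ++ b) := by simp [hc₁]
    rw [e, List.take_left' (by simp; omega)]
    ext x; simp [ham]
    by_cases hx : x = s <;> simp [hx, hst.1]
  · have e : a.reverse ++ p.support ++ b = (a.reverse ++ c₂) ++ (t :: b) := by simp [hc₂]
    rw [e, List.drop_left' (by simp; omega)]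
    ext x; simp [hbm]
    by_cases hx : x = t <;> simp [hx, hst.2]
  · intro i hi
    simp only [List.length_append, List.length_reverse] at hi
    -- The core of window `i` is the path node `q` at this position. The truncated subtraction
    -- yields `q = s` for windows that begin inside `a`.
    have hk : i - a.length < p.support.length := by omega
    obtain ⟨d₁, q, d₂, hd, hd₁⟩ : ∃ d₁ q d₂, p.support = d₁ ++ q :: d₂ ∧
        d₁.length = i - a.length :=
      ⟨p.support.take (i - a.length), p.support[i - a.length], p.support.drop (i - a.length + 1),
        by rw [← List.drop_eq_getElem_cons, List.take_append_drop], by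
          rw [List.length_take]; omega⟩
    have e : a.reverse ++ p.support ++ b = (d₁.reverse ++ a).reverse ++ [q] ++ (d₂ ++ b) := by
      simp [hd]
    have hs : s ∈ d₁ ++ [q] := by
      cases d₁ with
      | nil => simp_all
      | cons x d => simp_all
    have ht : t ∈ q :: d₂ := by
      have : t = (q :: d₂).getLast (by simp) := by
        have h₁ : p.support.getLast? = some t := by rw [hc₂]; simp
        rw [hd, List.getLast?_append_of_ne_nil _ (by simp), List.getLast?_eq_some_getLast (by simp)]
          at h₁
        exact (Option.some.inj h₁).symm
      rw [this]; exact List.getLast_mem _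
    rw [hd] at hchain
    have hq : {x | x ∈ [q]} = {q} := by ext; simp
    rw [e]
    refine window_connected ?_ ?_ ?_ ?_ ?_
    · rw [hq]; exact induce_singleton_connected q
    · rw [hq]
      refine .append (attaches_of_isChain ?_) (haA.mono ?_)
      · have : List.IsChain G.Adj (d₁ ++ [q]).reverse := by
          rw [List.isChain_reverse]
          have h' : List.IsChain G.Adj (d₁ ++ [q]) :=
            List.IsChain.left_of_append (l₂ := d₂) (by simpa using hchain)
          exact h'.imp fun _ _ h => h.symm
        simpa using this
      · simpa [or_comm] using hs
    · rw [hq]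
      refine .append (attaches_of_isChain hchain.right_of_append) (hbA.mono ?_)
      simpa using ht
    · simp; omega
    · simp; omega

lemma IsTree.exists_slides [DecidableEq V] (hG : G.IsTree) {m : ℕ} {S T : Finset V}
    (hS : (G.induce (S : Set V)).Connected) (hT : (G.induce (T : Set V)).Connected)
    (hSm : S.card = m) (hTm : T.card = m) : ∃ l, G.Slides m S T l := by
  by_cases h : Disjoint S T
  · exact exists_slides_of_disjoint hG.connected hS hT hSm hTm h
  · exact exists_slides_of_inter hG.isAcyclic hS hT hSm hTm
      (Finset.not_disjoint_iff_nonempty_inter.1 h)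

end SimpleGraph

/-! ### All colour counts occur among the windows -/

/-- A discrete intermediate value theorem. -/
lemma exists_eq_of_le_of_succ_le {g : ℕ → ℕ} {b : ℕ} (h₀ : g 0 ≤ b) :
    ∀ {K : ℕ}, b ≤ g K → (∀ i < K, g (i + 1) ≤ g i + 1) → ∃ i ≤ K, g i = b
  | 0, h, _ => ⟨0, le_rfl, by omega⟩
  | K + 1, h, hg => by
    by_cases hK : b ≤ g K
    · obtain ⟨i, hi, e⟩ := exists_eq_of_le_of_succ_le h₀ hK fun i hi => hg i (by omega)
      exact ⟨i, by omega, e⟩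
    · exact ⟨K + 1, le_rfl, by have := hg K (by omega); omega⟩

/-- The shifted window loses its first entry and gains at most one new entry. -/
lemma List.countP_window_succ_le {α : Type*} (p : α → Bool) (l : List α) (m i : ℕ) :
    ((l.drop (i + 1)).take m).countP p ≤ ((l.drop i).take m).countP p + 1 := by
  rw [← List.drop_drop]
  cases m with
  | zero => simp
  | succ k =>
    cases l.drop i with
    | nil => simp
    | cons y t =>
      have : t[k]?.toList.countP p ≤ 1 :=
        List.countP_le_length.trans (by cases t[k]? <;> simp)
      simp only [List.drop_succ_cons, List.drop_zero, List.take_succ_cons, List.countP_cons]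
      rw [List.take_add_one, List.countP_append]
      omega

lemma List.Nodup.card_filter_toFinset {α : Type*} [DecidableEq α] {l : List α} (h : l.Nodup)
    (p : α → Prop) [DecidablePred p] :
    (l.toFinset.filter p).card = l.countP (fun x => decide (p x)) := by
  have e : l.toFinset.filter p = (l.filter (fun x => decide (p x))).toFinset := by ext; simp
  rw [e, List.toFinset_card_of_nodup (h.filter _), List.countP_eq_length_filter]

lemma card_black_add_card_white {V : Type*} (white : V → Bool) (S : Finset V) :
    (S.filter (fun v => white v = false)).card + (S.filter (fun v => white v = true)).card
      = S.card := by
  have := Finset.card_filter_add_card_filter_not (s := S) (fun v => white v = false)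
  simpa using this

/-- In a tree, one list of distinct nodes has all realizable colour multisets of size `m` among its
windows of length `m`. -/
theorem SimpleGraph.IsTree.exists_windows {V : Type*} [Fintype V] [DecidableEq V]
    {G : SimpleGraph V} (hG : G.IsTree) (white : V → Bool) (m : ℕ) :
    ∃ l : List V, l.Nodup ∧ ∀ b w, b + w = m → (∃ S, IsMatch G white b w S) →
      ∃ i, i + m ≤ l.length ∧ IsMatch G white b w ((l.drop i).take m).toFinset := by
  classical
  let F : Finset (Finset V) :=
    Finset.univ.filter fun S => (G.induce (S : Set V)).Connected ∧ S.card = m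
  have hF : ∀ {S}, S ∈ F ↔ (G.induce (S : Set V)).Connected ∧ S.card = m := by simp [F]
  have hmatch : ∀ {b w S}, b + w = m → IsMatch G white b w S → S ∈ F := by
    rintro b w S rfl ⟨h₁, rfl, rfl⟩
    exact hF.2 ⟨h₁, (card_black_add_card_white white S).symm⟩
  by_cases hne : F.Nonempty
  · let f : Finset V → ℕ := fun S => (S.filter (fun v => white v = false)).card
    obtain ⟨S, hS, hSmin⟩ := F.exists_min_image f hne
    obtain ⟨T, hT, hTmax⟩ := F.exists_max_image f hne
    rw [hF] at hS hT
    obtain ⟨l, hl, hlm, hlS, hlT, hconn⟩ := hG.exists_slides hS.1 hT.1 hS.2 hT.2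
    refine ⟨l, hl, fun b w hbw ⟨U, hU⟩ => ?_⟩
    have hUF := hmatch hbw hU
    have hfU : f U = b := hU.2.1
    have hnd : ∀ i, ((l.drop i).take m).Nodup := fun i =>
      hl.sublist ((List.take_sublist _ _).trans (List.drop_sublist _ _))
    let g : ℕ → ℕ := fun i => f ((l.drop i).take m).toFinset
    have hg : ∀ i, g (i + 1) ≤ g i + 1 := fun i => by
      simp only [g, f]
      rw [(hnd _).card_filter_toFinset, (hnd _).card_filter_toFinset]
      exact List.countP_window_succ_le _ l m i
    obtain ⟨i, hi, hgi⟩ := exists_eq_of_le_of_succ_le (g := g) (b := b) (K := l.length - m)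
      (by simpa [g, hlS, ← hfU] using hSmin U hUF)
      (by
        have e : (l.drop (l.length - m)).take m = l.drop (l.length - m) :=
          List.take_of_length_le (by simp; omega)
        simpa only [g, e, hlT, ← hfU] using hTmax U hUF)
      (fun i _ => hg i)
    refine ⟨i, by omega, ?_, hgi, ?_⟩
    · rw [List.coe_toFinset]
      exact hconn i (by omega)
    -- With `m` nodes in the window, the black count determines the white count.
    · have h₁ := card_black_add_card_white white ((l.drop i).take m).toFinset
      have h₂ : ((l.drop i).take m).toFinset.card = m := by
        rw [List.toFinset_card_of_nodup (hnd i)]; simp; omega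
      simp only [g, f] at hgi
      omega
  · refine ⟨[], List.nodup_nil, fun b w hbw ⟨U, hU⟩ => (hne ⟨U, hmatch hbw hU⟩).elim⟩

/-! ### The query program and its running time -/

namespace WordRAM

lemma HaltsWithin.of_step {W : ℕ} {P : Program} {T : ℕ} {c c₁ c' : Config}
    (h : step W P c = some c₁) (h' : HaltsWithin W P T c₁ c') :
    HaltsWithin W P (T + 1) c c' := by
  obtain ⟨t, ht, hs, hn⟩ := h'
  exact ⟨t + 1, by omega, by simp [steps, h, hs], hn⟩

lemma HaltsWithin.of_halted {W : ℕ} {P : Program} {c : Config} (T : ℕ)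
    (h : step W P c = none) : HaltsWithin W P T c c :=
  ⟨0, Nat.zero_le _, rfl, h⟩

lemma HaltsWithin.mono {W : ℕ} {P : Program} {T T' : ℕ} {c c' : Config}
    (h : HaltsWithin W P T c c') (hT : T ≤ T') : HaltsWithin W P T' c c' := by
  obtain ⟨t, ht, h⟩ := h
  exact ⟨t, ht.trans hT, h⟩

end WordRAM

open WordRAM

/-- The query program.  Cell `0` of the index holds the number `n` of nodes, cell
`1 + (n + 1) * b + w` holds for `b, w ≤ n` the address of a block of `b + w` cells listing the
nodes of a match for `b` black and `w` white nodes, or `0` if there is none. -/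
def windowQuery : Program := [
  .load 2 2,
  .jumpLt 2 0 17,
  .jumpLt 2 1 17,
  .const 3 1,
  .bin .add 2 2 3,
  .bin .mul 2 2 0,
  .bin .add 2 2 1,
  .bin .add 2 2 3,
  .load 2 2,
  .jumpEq 2 4 17,
  .bin .add 0 0 1,
  .bin .add 0 0 2,
  .jumpEq 2 0 17,
  .load 1 2,
  .output 1,
  .bin .add 2 2 3,
  .jump 12]

/-- Register `2` is the current address and register `0` the end of the block. Each node costs five
instructions, and the last test jumps to `17`, just past the program, where the machine stops. -/
lemma windowQuery_loop {W : ℕ} {mem : ℕ → ℕ} (k : ℕ) : ∀ (p : ℕ) (reg : ℕ → ℕ) (o : List ℕ),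
    p + k < 2 ^ W → reg 2 = p → reg 0 = p + k → reg 3 = 1 →
    ∃ c, HaltsWithin W windowQuery (5 * k + 1) ⟨12, reg, mem, o⟩ c ∧
      c.out = o ++ (List.range' p k).map mem ∧ c.mem = mem := by
  induction k with
  | zero =>
    intro p reg o _ h₂ h₀ _
    refine ⟨_, .of_step (c₁ := ⟨17, reg, mem, o⟩) ?_ (.of_halted _ rfl), by simp, rfl⟩
    simp [step, windowQuery, Instr.exec, h₂, h₀]
  | succ k ih =>
    intro p reg o hp h₂ h₀ h₃
    obtain ⟨c, hc, hout, hmem⟩ := ih (p + 1)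
      (Function.update (Function.update reg 1 (mem p)) 2 (p + 1)) (o ++ [mem p])
      (by omega) (by simp) (by simp [h₀]; omega) (by simp [h₃])
    refine ⟨c, ?_, by simp [hout, List.range'_succ], hmem⟩
    have hne : ¬ p = p + (k + 1) := by omega
    have hmod : (p + 1) % 2 ^ W = p + 1 := Nat.mod_eq_of_lt (by omega)
    refine .of_step (c₁ := ⟨13, reg, mem, o⟩) (by
      simp [step, windowQuery, Instr.exec, h₂, h₀]) ?_
    refine .of_step (c₁ := ⟨14, Function.update reg 1 (mem p), mem, o⟩) (by
      simp [step, windowQuery, Instr.exec, h₂]) ?_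
    refine .of_step (c₁ := ⟨15, Function.update reg 1 (mem p), mem, o ++ [mem p]⟩) (by
      simp [step, windowQuery, Instr.exec]) ?_
    refine .of_step (c₁ := ⟨16, _, mem, o ++ [mem p]⟩) (by
      simp [step, windowQuery, Instr.exec, BinOp.eval, h₂, h₃, hmod]; rfl) ?_
    exact .of_step (by simp [step, windowQuery, Instr.exec]) hc

/-- The answer of the query program when both numbers are at most `mem 0`. -/
lemma windowQuery_of_le {W : ℕ} {mem : ℕ → ℕ} {b w n p : ℕ} (hn : mem 0 = n) (hb : b ≤ n)
    (hw : w ≤ n) (hs : 1 + (n + 1) * b + w < 2 ^ W) (hnW : n + 1 < 2 ^ W)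
    (hp : mem (1 + (n + 1) * b + w) = p) (hpW : p ≠ 0 → p + (b + w) < 2 ^ W) :
    ∃ c, HaltsWithin W windowQuery (5 * (b + w) + 13) (start mem b w) c ∧
      c.out = (if p = 0 then [] else (List.range' p (b + w)).map mem) ∧ c.mem = mem := by
  -- During the lookup only registers `2` and `3` change. Register `4` stays `0` and serves as the
  -- null pointer in the test at instruction `9`.
  let R : ℕ → ℕ → ℕ → ℕ := fun x y r =>
    if r = 0 then b else if r = 1 then w else if r = 2 then x else if r = 3 then y else 0
  have hR : ∀ x y z, Function.update (R x y) 2 z = R z y := by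
    intro x y z; ext r; simp only [R, Function.update_apply]; split_ifs <;> omega
  -- The nine instructions that fetch the pointer; the size bounds rule out any wrap-around modulo
  -- `2 ^ W`.
  have hstep : ∀ T c₁, HaltsWithin W windowQuery T ⟨9, R p 1, mem, []⟩ c₁ →
      HaltsWithin W windowQuery (T + 9) (start mem b w) c₁ := by
    intro T c₁ h
    have h1 : 1 % 2 ^ W = 1 := Nat.mod_eq_of_lt (by omega)
    have h2 : (n + 1) % 2 ^ W = n + 1 := Nat.mod_eq_of_lt hnW
    have h3 : ((n + 1) * b) % 2 ^ W = (n + 1) * b := Nat.mod_eq_of_lt (by omega)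
    have h4 : ((n + 1) * b + w) % 2 ^ W = (n + 1) * b + w := Nat.mod_eq_of_lt (by omega)
    have h5 : ((n + 1) * b + w + 1) % 2 ^ W = (n + 1) * b + w + 1 :=
      Nat.mod_eq_of_lt (by omega)
    have hp' : mem ((n + 1) * b + w + 1) = p := by rw [← hp]; congr 1; omega
    have hst : start mem b w = ⟨0, R 0 0, mem, []⟩ := by
      simp only [start, R]; congr; ext r; split_ifs <;> rfl
    rw [hst]
    refine .of_step (c₁ := ⟨1, R n 0, mem, []⟩) (by
      simp [step, windowQuery, Instr.exec, hR]; simp [R, hn]) ?_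
    refine .of_step (c₁ := ⟨2, R n 0, mem, []⟩) (by
      simp [step, windowQuery, Instr.exec]; simpa [R] using hb) ?_
    refine .of_step (c₁ := ⟨3, R n 0, mem, []⟩) (by
      simp [step, windowQuery, Instr.exec]; simpa [R] using hw) ?_
    refine .of_step (c₁ := ⟨4, R n 1, mem, []⟩) (by
      simp [step, windowQuery, Instr.exec, h1]; ext r
      simp only [R, Function.update_apply]; split_ifs <;> omega) ?_
    refine .of_step (c₁ := ⟨5, R (n + 1) 1, mem, []⟩) (by
      simp [step, windowQuery, Instr.exec, BinOp.eval, hR]; simp [R, h2]) ?_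
    refine .of_step (c₁ := ⟨6, R ((n + 1) * b) 1, mem, []⟩) (by
      simp [step, windowQuery, Instr.exec, BinOp.eval, hR]; simp [R, h3]) ?_
    refine .of_step (c₁ := ⟨7, R ((n + 1) * b + w) 1, mem, []⟩) (by
      simp [step, windowQuery, Instr.exec, BinOp.eval, hR]; simp [R, h4]) ?_
    refine .of_step (c₁ := ⟨8, R ((n + 1) * b + w + 1) 1, mem, []⟩) (by
      simp [step, windowQuery, Instr.exec, BinOp.eval, hR]; simp [R, h5]) ?_
    exact .of_step (by simp [step, windowQuery, Instr.exec, hR]; simp [R, hp']) h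
  by_cases h : p = 0
  · refine ⟨⟨17, R p 1, mem, []⟩, ?_, by simp [h], rfl⟩
    refine (hstep 1 _ (.of_step ?_ (.of_halted 0 rfl))).mono (by omega)
    simp [step, windowQuery, Instr.exec]; simp [R, h]
  · have hpW := hpW h
    have h1 : (b + w) % 2 ^ W = b + w := Nat.mod_eq_of_lt (by omega)
    have h2 : (b + w + p) % 2 ^ W = b + w + p := Nat.mod_eq_of_lt (by omega)
    obtain ⟨c, hc, hout, hmem⟩ := windowQuery_loop (W := W) (mem := mem) (b + w) p
      (Function.update (Function.update (R p 1) 0 (b + w)) 0 (b + w + p)) [] hpW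
      (by simp [R]) (by simp; omega) (by simp [R])
    refine ⟨c, hstep _ _ ?_, by simp [hout, h], hmem⟩
    refine .of_step (c₁ := ⟨10, R p 1, mem, []⟩) (by
      simp [step, windowQuery, Instr.exec]; simpa [R] using h) ?_
    refine .of_step (c₁ := ⟨11, Function.update (R p 1) 0 (b + w), mem, []⟩) (by
      simp [step, windowQuery, Instr.exec, BinOp.eval]; simp [R, h1]) ?_
    refine .of_step (c₁ := ⟨12, _, mem, []⟩) (by
      simp [step, windowQuery, Instr.exec, BinOp.eval]; simp [R, h2]) hc

/-- Oversized inputs are rejected before any address arithmetic, which could overflow. -/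
lemma windowQuery_of_lt {W : ℕ} {mem : ℕ → ℕ} {b w : ℕ} (h : mem 0 < b ∨ mem 0 < w) :
    ∃ c, HaltsWithin W windowQuery 3 (start mem b w) c ∧ c.out = [] ∧ c.mem = mem := by
  let reg : ℕ → ℕ := Function.update (start mem b w).reg 2 (mem 0)
  refine ⟨⟨17, reg, mem, []⟩, ?_, rfl, rfl⟩
  refine .of_step (c₁ := ⟨1, reg, mem, []⟩) (by
    simp [step, windowQuery, Instr.exec, start, reg]) ?_
  by_cases hb : mem 0 < b
  · refine .of_step (c₁ := ⟨17, reg, mem, []⟩) (by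
      simp [step, windowQuery, Instr.exec]; simp [start, reg, hb]) (.of_halted _ rfl)
  · have hw : mem 0 < w := h.resolve_left hb
    refine .of_step (c₁ := ⟨2, reg, mem, []⟩) (by
      simp [step, windowQuery, Instr.exec]; simpa [start, reg] using hb) ?_
    refine .of_step (c₁ := ⟨17, reg, mem, []⟩) (by
      simp [step, windowQuery, Instr.exec]; simp [start, reg, hw]) (.of_halted _ rfl)

/-! ### Layout and correctness of the index -/

open Classical in
/-- The pointer stored for the query `(b, w)`: the address of a window of the list `A (b + w)` that
is a match, or `0`.  The lists `A 0, A 1, …` are stored in blocks of `n` cells from `base` on. -/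
noncomputable def windowPtr {n : ℕ} (G : SimpleGraph (Fin n)) (white : Fin n → Bool)
    (A : ℕ → List (Fin n)) (base b w : ℕ) : ℕ :=
  if h : ∃ i, i + (b + w) ≤ (A (b + w)).length ∧
      IsMatch G white b w (((A (b + w)).drop i).take (b + w)).toFinset then
    base + (b + w) * n + h.choose
  else 0

/-- The contents of the cells of the index. -/
noncomputable def windowCell {n : ℕ} (G : SimpleGraph (Fin n)) (white : Fin n → Bool)
    (A : ℕ → List (Fin n)) (a : ℕ) : ℕ :=
  if a = 0 then n
  else if a < 1 + (n + 1) ^ 2 then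
    windowPtr G white A (1 + (n + 1) ^ 2) ((a - 1) / (n + 1)) ((a - 1) % (n + 1))
  -- The default `0` fills the unused end of a block of `n` cells.
  else ((A ((a - (1 + (n + 1) ^ 2)) / n))[(a - (1 + (n + 1) ^ 2)) % n]?.map Fin.val).getD 0

section

variable {n : ℕ} {G : SimpleGraph (Fin n)} {white : Fin n → Bool} {A : ℕ → List (Fin n)}

lemma IsMatch.add_le {b w : ℕ} {S : Finset (Fin n)} (h : IsMatch G white b w S) : b + w ≤ n := by
  rw [← h.2.1, ← h.2.2, card_black_add_card_white]
  simpa using S.card_le_univ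

lemma windowPtr_spec {base b w : ℕ} (h : windowPtr G white A base b w ≠ 0) :
    ∃ i, windowPtr G white A base b w = base + (b + w) * n + i ∧
      i + (b + w) ≤ (A (b + w)).length ∧
      IsMatch G white b w (((A (b + w)).drop i).take (b + w)).toFinset := by
  unfold windowPtr at h ⊢
  split_ifs at h ⊢ with h'
  · exact ⟨_, rfl, h'.choose_spec⟩
  · exact absurd rfl h

lemma windowPtr_ne_zero {base b w : ℕ} (hbase : 0 < base)
    (h : ∃ i, i + (b + w) ≤ (A (b + w)).length ∧
      IsMatch G white b w (((A (b + w)).drop i).take (b + w)).toFinset) :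
    windowPtr G white A base b w ≠ 0 := by
  unfold windowPtr
  rw [dif_pos h]
  omega

/-- A match has `b + w ≤ n` nodes and its window ends within a block of `n` cells, so reading it
stays inside the index. This also bounds the stored pointers. -/
lemma windowPtr_add_le (hA : ∀ m, (A m).length ≤ n) {base b w : ℕ}
    (h : windowPtr G white A base b w ≠ 0) :
    windowPtr G white A base b w + (b + w) ≤ base + (n + 1) * n := by
  obtain ⟨i, hi, hil, hm⟩ := windowPtr_spec h
  have h₁ := hA (b + w)
  have h₂ := Nat.mul_le_mul_right n hm.add_le
  rw [hi]
  linarith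

lemma windowCell_ptr {b w : ℕ} (hb : b ≤ n) (hw : w ≤ n) :
    windowCell G white A (1 + (n + 1) * b + w) =
      windowPtr G white A (1 + (n + 1) ^ 2) b w := by
  have h₁ : (n + 1) * b + w < (n + 1) ^ 2 := by nlinarith
  have e : 1 + (n + 1) * b + w - 1 = w + (n + 1) * b := by omega
  unfold windowCell
  rw [if_neg (by omega), if_pos (by omega), e, Nat.add_mul_div_left _ _ (by omega),
    Nat.div_eq_of_lt (by omega), Nat.add_mul_mod_self_left, Nat.mod_eq_of_lt (by omega), zero_add]

lemma windowCell_list (hA : ∀ m, (A m).length ≤ n) {m i : ℕ} (hi : i < (A m).length) :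
    windowCell G white A (1 + (n + 1) ^ 2 + m * n + i) = (A m)[i].val := by
  have hn := hA m
  have e : 1 + (n + 1) ^ 2 + m * n + i - (1 + (n + 1) ^ 2) = i + n * m := by
    rw [mul_comm n m]; omega
  unfold windowCell
  rw [if_neg (by omega), if_neg (by omega), e, Nat.add_mul_div_left _ _ (by omega),
    Nat.div_eq_of_lt (by omega), Nat.add_mul_mod_self_left, Nat.mod_eq_of_lt (by omega), zero_add]
  simp [hi]

lemma windowCell_le (hA : ∀ m, (A m).length ≤ n) (a : ℕ) :
    windowCell G white A a ≤ 1 + (n + 1) ^ 2 + (n + 1) * n := by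
  unfold windowCell
  split_ifs with h₁ h₂
  · nlinarith
  · by_cases h : windowPtr G white A (1 + (n + 1) ^ 2) ((a - 1) / (n + 1)) ((a - 1) % (n + 1)) = 0
    · omega
    · have := windowPtr_add_le hA h
      exact (Nat.le_add_right _ _).trans this
  · cases (A ((a - (1 + (n + 1) ^ 2)) / n))[(a - (1 + (n + 1) ^ 2)) % n]? with
    | none => simp
    | some v =>
      have := v.2
      simp
      nlinarith

/-- The index of a two-coloured tree. -/
noncomputable def windowIndex (G : SimpleGraph (Fin n)) (white : Fin n → Bool)
    (A : ℕ → List (Fin n)) : List ℕ :=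
  (List.range (1 + (n + 1) ^ 2 + (n + 1) * n)).map (windowCell G white A)

lemma isIndexFor_windowIndex (hn : 1 ≤ n) (hA : ∀ m, (A m).Nodup)
    (hAm : ∀ b w, (∃ S, IsMatch G white b w S) → ∃ i, i + (b + w) ≤ (A (b + w)).length ∧
      IsMatch G white b w (((A (b + w)).drop i).take (b + w)).toFinset)
    {W : ℕ} (hW : 20 * n ^ 2 ≤ 2 ^ W) :
    IsIndexFor G white windowQuery 20 W (windowIndex G white A) := by
  have hAl : ∀ m, (A m).length ≤ n := fun m => by simpa using (hA m).length_le_card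
  intro mem _ hst b w _ _ hbw
  set L := 1 + (n + 1) ^ 2 + (n + 1) * n with hL
  have hLW : L < 2 ^ W := by nlinarith
  have hcell : ∀ a < L, mem a = windowCell G white A a := by
    intro a ha
    have := hst a (by simpa [windowIndex] using ha)
    simpa [windowIndex] using this
  have hmem0 : mem 0 = n := by
    rw [hcell 0 (by omega)]; simp [windowCell]
  by_cases hle : b ≤ n ∧ w ≤ n
  · obtain ⟨hb, hw⟩ := hle
    have hadr : 1 + (n + 1) * b + w < L := by nlinarith
    have hptr : mem (1 + (n + 1) * b + w) = windowPtr G white A (1 + (n + 1) ^ 2) b w := by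
      rw [hcell _ hadr, windowCell_ptr hb hw]
    obtain ⟨c, hc, hout, hmem⟩ := windowQuery_of_le (W := W) hmem0 hb hw (by omega)
      (by nlinarith) hptr (fun h => (windowPtr_add_le hAl h).trans_lt hLW)
    refine ⟨c, hc.mono (by omega), ⟨fun hS => ?_, fun hS => ?_⟩, by rwa [hmem]⟩
    · have hne : windowPtr G white A (1 + (n + 1) ^ 2) b w ≠ 0 :=
        windowPtr_ne_zero (by omega) (hAm b w hS)
      obtain ⟨i, hi, hil, hM⟩ := windowPtr_spec hne
      refine ⟨_, (hA (b + w)).sublist ((List.take_sublist _ _).trans (List.drop_sublist _ _)),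
        hM, ?_⟩
      have hend := windowPtr_add_le hAl hne
      rw [hout, if_neg hne]
      apply List.ext_getElem
      · simp; omega
      · intro j h₁ h₂
        simp only [List.length_map, List.length_range'] at h₁
        simp only [List.getElem_map, List.getElem_range', List.getElem_take, List.getElem_drop,
          one_mul]
        rw [hcell _ (by omega), hi, add_assoc _ i j, windowCell_list hAl (by omega)]
    · rw [hout, if_pos]
      by_contra hne
      obtain ⟨i, -, -, hM⟩ := windowPtr_spec hne
      exact hS ⟨_, hM⟩
  · obtain ⟨c, hc, hout, hmem⟩ := windowQuery_of_lt (W := W) (mem := mem) (b := b) (w := w)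
      (by omega)
    refine ⟨c, hc.mono (by omega), ⟨fun ⟨S, hS⟩ => ?_, fun _ => hout⟩, by rwa [hmem]⟩
    have := hS.add_le
    omega

end

/-- There are a query program and a constant `C` such that every tree on `n` nodes, coloured black
and white, has an index of at most `C * n ^ 2` words (each of `O(log n)` bits) with which the
program finds a match for `b` black and `w` white nodes, or reports that there is none, in at most
`C * (b + w)` time steps, on every word-RAM whose words are long enough to address
`C * n ^ 2` memory cells. -/
theorem theorem2 :
    ∃ (query : WordRAM.Program) (C : ℕ),
      ∀ (n : ℕ) (G : SimpleGraph (Fin n)) (white : Fin n → Bool), G.IsTree →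
        ∃ idx : List ℕ,
          idx.length ≤ C * n ^ 2 ∧ (∀ x ∈ idx, x < C * n ^ 2) ∧
          ∀ W : ℕ, C * n ^ 2 ≤ 2 ^ W → IsIndexFor G white query C W idx := by
  -- The constant `20` covers the time `5 * (b + w) + 13 ≤ 18 * (b + w)` as well as the size `2 * n
  -- ^ 2 + 3 * n + 2 ≤ 7 * n ^ 2` of the index, which also bounds its entries.
  refine ⟨windowQuery, 20, fun n G white hG => ?_⟩
  have hn : 1 ≤ n := by
    obtain ⟨v⟩ := hG.connected.nonempty
    exact Nat.succ_le_of_lt (Nat.zero_lt_of_lt v.2)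
  choose A hA hAm using fun m => hG.exists_windows white m
  refine ⟨windowIndex G white A, ?_, ?_, fun W hW =>
    isIndexFor_windowIndex hn hA (fun b w => hAm (b + w) b w rfl) hW⟩
  · simp [windowIndex]
    nlinarith
  · intro x hx
    obtain ⟨a, -, rfl⟩ := List.mem_map.1 hx
    have := windowCell_le (G := G) (white := white)
      (fun m => by simpa using (hA m).length_le_card) a
    nlinarith
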